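/- Let $c\ge 1$ be an integer, let $\vartheta$ be a real number with $\frac{c}{c+1}\le\vartheta\le 1$, and let $X_1,X_2,\ldots$ be i.i.d. with $\mathbb P(X_t=1)=\vartheta$ and $\mathbb P(X_t=0)=1-\vartheta$. Let $Z_0=0$ and let $Z_t$ ($t\ge 1$) be the random walk that at step $t$ moves by $-1$ if $X_t=1$ and by $+c$ if $X_t=0$; for $u\in\mathbb Z$ put $\pi(u)=\mathbb P(\exists\, t\ge 0: Z_t\ge u)$. Define $$\xi(w)=\frac{[(1-\vartheta)(c+1)-1]w^2+[2-(1-\vartheta)(c+1)]w-(1-\vartheta)w^{c+1}-\vartheta}{(1-\vartheta)w^{c+2}-(1-\vartheta)w^{c+1}-w^2+(1+\vartheta)w-\vartheta},\qquad w\in(-1,1).$$ Then the denominator has no zero in $(-1,1)$; if $\vartheta<1$, the numerator and the denominator, as displayed, are polynomials of degree $c+1$ and $c+2$; for every $w\in(-1,1)$ the series $\sum_{u=0}^\infty \pi(u)w^u$ converges to $\xi(w)$; and $$\pi(u)=\frac{\xi^{(u)}(0)}{u!}\qquad\text{for all integers } u\ge 0.$$ Consider further an agent whose prior belief about $\vartheta$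 is the Beta distribution with integer parameters $\alpha,\beta\ge 1$. The agent places trust in round $t\ge 1$ if and only if $\hat\vartheta_n-c(1-\hat\vartheta_n)\ge 0$ for all $n\in\{0,\ldots,t-1\}$, and observes $X_t$ exactly in the rounds in which trust is placed; here $\hat\vartheta_n$ is the mean of the posterior obtained by Bayes' rule from the prior and the observations made in rounds $1,\ldots,n$. Let $\tau=\inf\{t\ge 0:\hat\vartheta_t-c(1-\hat\vartheta_t)<0\}\in\{0,1,2,\ldots\}\cup\{\infty\}$ and $p_{\rm quit}=\mathbb P(\tau<\infty)$. Then, for all such $\alpha,\beta$, $$p_{\rm quit}=\pi(u_{\rm crit}),\qquad u_{\rm crit}=\alpha-c\beta+1.$$ -/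

import Mathlib

open MeasureTheory ProbabilityTheory Polynomial

noncomputable section

namespace TrustModel

/-! ### Beliefs of the agent -/

/-- Density on `[0,1]` of the Beta prior with parameters `α, β ≥ 1`. -/
def priorDensity (α β : ℕ) (θ : ℝ) : ℝ :=
  θ ^ (α - 1) * (1 - θ) ^ (β - 1) / ∫ y in (0 : ℝ)..1, y ^ (α - 1) * (1 - y) ^ (β - 1)

/-- Density on `[0,1]` of the posterior belief (Bayes' rule) after `s` observations that trust was
honoured and `f` observations that trust was abused. -/
def posteriorDensity (α β s f : ℕ) (θ : ℝ) : ℝ :=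
  θ ^ s * (1 - θ) ^ f * priorDensity α β θ /
    ∫ y in (0 : ℝ)..1, y ^ s * (1 - y) ^ f * priorDensity α β y

/-- Estimated trustworthiness: the mean of the posterior belief. -/
def estimate (α β s f : ℕ) : ℝ :=
  ∫ θ in (0 : ℝ)..1, θ * posteriorDensity α β s f θ

/-- Estimated expected utility of placing trust once more, with reward `r` and cost `c`. -/
def expectedUtility (α β c r s f : ℕ) : ℝ :=
  (r : ℝ) * estimate α β s f - (c : ℝ) * (1 - estimate α β s f)

/-! ### Dynamics of the agent

Rounds are numbered `1, 2, …`; `x t = true` means that trust placed in round `t` is honoured and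
`x t = false` that it is abused (`x 0` plays no role). -/

/-- The triple (trust is placed in round `t`, number of honoured, number of abused placements
observed up to the end of round `t`). At `t = 0` the first component is a dummy `True`. -/
def agentState (α β c r : ℕ) (x : ℕ → Bool) : ℕ → Prop × ℕ × ℕ
  | 0 => (True, 0, 0)
  | t + 1 =>
    let p := agentState α β c r x t
    let a : Prop := p.1 ∧ 0 ≤ expectedUtility α β c r p.2.1 p.2.2
    open Classical in
    (a, p.2.1 + (if a ∧ x (t + 1) = true then 1 else 0),
      p.2.2 + (if a ∧ x (t + 1) = false then 1 else 0))

/-- The agent places trust in round `t` (for `t ≥ 1`). -/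
def placesTrust (α β c r : ℕ) (x : ℕ → Bool) (t : ℕ) : Prop := (agentState α β c r x t).1

/-- Number of times the agent observed, up to round `t`, that trust was honoured. -/
def honoured (α β c r : ℕ) (x : ℕ → Bool) (t : ℕ) : ℕ := (agentState α β c r x t).2.1

/-- Number of times the agent observed, up to round `t`, that trust was abused. -/
def abused (α β c r : ℕ) (x : ℕ → Bool) (t : ℕ) : ℕ := (agentState α β c r x t).2.2

/-- Estimated expected utility at the end of round `t`. -/
def utilityAt (α β c r : ℕ) (x : ℕ → Bool) (t : ℕ) : ℝ :=
  expectedUtility α β c r (honoured α β c r x t) (abused α β c r x t)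

/-- Trust is placed in round `t` iff all previous estimates gave a nonnegative utility. -/
theorem placesTrust_iff (α β c r : ℕ) (x : ℕ → Bool) (t : ℕ) :
    placesTrust α β c r x t ↔ ∀ n < t, 0 ≤ utilityAt α β c r x n := by
  induction t with
  | zero => simp [placesTrust, agentState]
  | succ t ih =>
    rw [Nat.forall_lt_succ_right, ← ih]
    rfl

open Classical in
theorem honoured_eq_sum (α β c r : ℕ) (x : ℕ → Bool) (t : ℕ) :
    honoured α β c r x t =
      ∑ s ∈ Finset.Icc 1 t, if placesTrust α β c r x s ∧ x s = true then 1 else 0 := by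
  induction t with
  | zero => simp [honoured, agentState]
  | succ t ih =>
    rw [Finset.sum_Icc_succ_top (by omega), ← ih]
    simp only [honoured, placesTrust, agentState]
    congr

open Classical in
theorem abused_eq_sum (α β c r : ℕ) (x : ℕ → Bool) (t : ℕ) :
    abused α β c r x t =
      ∑ s ∈ Finset.Icc 1 t, if placesTrust α β c r x s ∧ x s = false then 1 else 0 := by
  induction t with
  | zero => simp [abused, agentState]
  | succ t ih =>
    rw [Finset.sum_Icc_succ_top (by omega), ← ih]
    simp only [abused, placesTrust, agentState]
    congr

/-- The quitting time `τ = inf {t : estimated utility at time t is negative}`, possibly `∞`. -/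
def quittingTime (α β c r : ℕ) (x : ℕ → Bool) : ℕ∞ :=
  sInf {T : ℕ∞ | ∃ t : ℕ, T = (t : ℕ∞) ∧ utilityAt α β c r x t < 0}

/-- The quitting probability `P(τ < ∞)`, where `X t` is the institution's response in round `t`. -/
def quitProb {Ω : Type*} [MeasurableSpace Ω] (μ : Measure Ω) (X : ℕ → Ω → Bool)
    (α β c r : ℕ) : ℝ :=
  μ.real {ω | quittingTime α β c r (fun t => X t ω) < ⊤}

/-! ### The random walk -/

/-- The walk started at `0` that steps `-r` when the response is `true` and `+c` when it is
`false`. -/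
def walk (c r : ℕ) (x : ℕ → Bool) (t : ℕ) : ℤ :=
  ∑ s ∈ Finset.Icc 1 t, if x s = true then -(r : ℤ) else (c : ℤ)

/-- The probability that the walk ever reaches level `u` or higher. -/
def hitProb {Ω : Type*} [MeasurableSpace Ω] (μ : Measure Ω) (X : ℕ → Ω → Bool)
    (c r : ℕ) (u : ℤ) : ℝ :=
  μ.real {ω | ∃ t : ℕ, u ≤ walk c r (fun s => X s ω) t}

/-- The critical level `rα - cβ + 1`. -/
def uCrit (α β c r : ℕ) : ℤ := (r : ℤ) * α - (c : ℤ) * β + 1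

/-! ### The generating function -/

/-- Numerator of `ξ`. -/
def xiNum (c : ℕ) (ϑ : ℝ) : ℝ[X] :=
  C ((1 - ϑ) * ((c : ℝ) + 1) - 1) * X ^ 2 + C (2 - (1 - ϑ) * ((c : ℝ) + 1)) * X
    - C (1 - ϑ) * X ^ (c + 1) - C ϑ

/-- Denominator of `ξ`. -/
def xiDen (c : ℕ) (ϑ : ℝ) : ℝ[X] :=
  C (1 - ϑ) * X ^ (c + 2) - C (1 - ϑ) * X ^ (c + 1) - X ^ 2 + C (1 + ϑ) * X - C ϑ

/-- The rational function `ξ`. -/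
def xi (c : ℕ) (ϑ : ℝ) (w : ℝ) : ℝ := (xiNum c ϑ).eval w / (xiDen c ϑ).eval w

end TrustModel

end

namespace TrustModel

/-! ### The posterior mean -/

/-! The posterior mean is `(α + s) / (α + β + s + f)`, so utility is negative exactly when `c * f -
s` has reached `uCrit`. Until the agent quits it observes every response, so `c * f - s` is the
walk: quitting and hitting are the same event, path by path (`quittingTime_lt_top_iff`).

Write `A` for the hitting probability and `p` for `ϑ`. First-step analysis gives `A u = p * A (u +
1) + (1 - p) * A (u - c)` for `u > 0`, with `A = 1` on `u ≤ 0`. Summed against powers of `w`, this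
is a linear equation for the generating function whose only other unknown is `A 1`. A conserved
quantity of the recurrence (`mul_apply_one_eq`), compared at `0` and at infinity, gives `p * A 1 =
(1 - p) * c`. The contribution at infinity vanishes because the drift is nonpositive: zero drift
cancels its coefficient, and negative drift makes `A` decay exponentially. -/

theorem beta_integral_pos (a b : ℕ) : 0 < ∫ y in (0 : ℝ)..1, y ^ a * (1 - y) ^ b := by
  refine intervalIntegral.intervalIntegral_pos_of_pos_on
    (Continuous.intervalIntegrable (by fun_prop) _ _) (fun y hy => ?_) one_pos
  have h1 : 0 < 1 - y := sub_pos.2 hy.2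
  have h0 : 0 < y := hy.1
  positivity

/-- Integrate the derivative of `y ^ (a + 1) * (1 - y) ^ (b + 1)`, which vanishes at both endpoints.
-/
theorem beta_integral_succ (a b : ℕ) :
    ((a : ℝ) + b + 2) * ∫ y in (0 : ℝ)..1, y ^ (a + 1) * (1 - y) ^ b =
      ((a : ℝ) + 1) * ∫ y in (0 : ℝ)..1, y ^ a * (1 - y) ^ b := by
  have key : ∫ y in (0 : ℝ)..1, (((a : ℝ) + 1) * (y ^ a * (1 - y) ^ b) -
      ((a : ℝ) + b + 2) * (y ^ (a + 1) * (1 - y) ^ b)) =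
      (1 : ℝ) ^ (a + 1) * (1 - 1) ^ (b + 1) - (0 : ℝ) ^ (a + 1) * (1 - 0) ^ (b + 1) := by
    refine intervalIntegral.integral_eq_sub_of_hasDerivAt
      (f := fun y : ℝ => y ^ (a + 1) * (1 - y) ^ (b + 1)) (fun y _ => ?_)
      (Continuous.intervalIntegrable (by fun_prop) _ _)
    have h := (hasDerivAt_pow (a + 1) y).mul (((hasDerivAt_id y).const_sub 1).pow (b + 1))
    convert! h using 1
    simp only [Nat.add_sub_cancel, id_eq, Pi.pow_apply]
    push_cast
    ring
  rw [intervalIntegral.integral_sub (Continuous.intervalIntegrable (by fun_prop) _ _)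
    (Continuous.intervalIntegrable (by fun_prop) _ _), intervalIntegral.integral_const_mul,
    intervalIntegral.integral_const_mul] at key
  simp at key
  linarith

theorem estimate_eq {α β : ℕ} (hα : 1 ≤ α) (hβ : 1 ≤ β) (s f : ℕ) :
    estimate α β s f = ((α : ℝ) + s) / (α + β + s + f) := by
  obtain ⟨a, rfl⟩ := Nat.exists_eq_add_of_le' hα
  obtain ⟨b, rfl⟩ := Nat.exists_eq_add_of_le' hβ
  have hK := beta_integral_pos a b
  have hI := beta_integral_pos (s + a) (f + b)
  have hS := beta_integral_succ (s + a) (f + b)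
  simp only [estimate, posteriorDensity, priorDensity, Nat.add_sub_cancel]
  set K := ∫ y in (0 : ℝ)..1, y ^ a * (1 - y) ^ b
  have h1 : ∀ y : ℝ, y ^ s * (1 - y) ^ f * (y ^ a * (1 - y) ^ b / K) =
      K⁻¹ * (y ^ (s + a) * (1 - y) ^ (f + b)) := fun y => by
    rw [pow_add, pow_add]; ring
  simp only [h1, intervalIntegral.integral_const_mul]
  set I := ∫ y in (0 : ℝ)..1, y ^ (s + a) * (1 - y) ^ (f + b)
  have h2 : ∀ y : ℝ, y * (K⁻¹ * (y ^ (s + a) * (1 - y) ^ (f + b)) / (K⁻¹ * I)) =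
      I⁻¹ * (y ^ (s + a + 1) * (1 - y) ^ (f + b)) := fun y => by
    rw [pow_succ y (s + a)]; field_simp
  simp only [h2, intervalIntegral.integral_const_mul]
  push_cast at hS ⊢
  rw [inv_mul_eq_div, div_eq_div_iff hI.ne' (by positivity)]
  linarith

/-- The sign is that of the integer `α + s - c * (β + f)`; an integer is negative iff it is at most
`-1`, hence the `+ 1` in `uCrit`. -/
theorem expectedUtility_neg_iff {α β : ℕ} (hα : 1 ≤ α) (hβ : 1 ≤ β) (c s f : ℕ) :
    expectedUtility α β c 1 s f < 0 ↔ uCrit α β c 1 ≤ (c : ℤ) * f - s := by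
  have hpos : (0 : ℝ) < α + β + s + f := by positivity
  have h : expectedUtility α β c 1 s f = ((α + s - c * (β + f) : ℤ) : ℝ) / (α + β + s + f) := by
    rw [expectedUtility, estimate_eq hα hβ]
    push_cast
    field_simp
    ring
  rw [h, div_neg_iff]
  simp only [hpos, hpos.not_gt, and_true, and_false, false_or, Int.cast_lt_zero, uCrit]
  constructor <;> intro h <;> push_cast at * <;> linarith

/-! ### Quitting and the random walk -/

theorem walk_succ (c : ℕ) (x : ℕ → Bool) (t : ℕ) :
    walk c 1 x (t + 1) = walk c 1 x t + if x (t + 1) = true then -1 else (c : ℤ) := by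
  simp [walk, Finset.sum_Icc_succ_top]

theorem walk_zero (c : ℕ) (x : ℕ → Bool) : walk c 1 x 0 = 0 := by simp [walk]

theorem walk_succ' (c : ℕ) (x : ℕ → Bool) (t : ℕ) :
    walk c 1 x (t + 1) =
      (if x 1 = true then -1 else (c : ℤ)) + walk c 1 (fun s => x (s + 1)) t := by
  induction t with
  | zero => simp [walk_succ, walk_zero]
  | succ t ih => rw [walk_succ, ih, walk_succ]; ring

theorem walk_congr (c : ℕ) {x y : ℕ → Bool} {t : ℕ} (h : ∀ s ∈ Finset.Icc 1 t, x s = y s) :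
    walk c 1 x t = walk c 1 y t :=
  Finset.sum_congr rfl fun s hs => by rw [h s hs]

theorem walk_eq_of_placesTrust {α β c : ℕ} {x : ℕ → Bool} {t : ℕ}
    (h : ∀ n < t, 0 ≤ utilityAt α β c 1 x n) :
    walk c 1 x t = (c : ℤ) * abused α β c 1 x t - honoured α β c 1 x t := by
  induction t with
  | zero => simp [walk_zero, honoured, abused, agentState]
  | succ t ih =>
    have hp : placesTrust α β c 1 x (t + 1) := (placesTrust_iff ..).2 h
    rw [walk_succ, ih fun n hn => h n (by omega), honoured_eq_sum α β c 1 x (t + 1),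
      abused_eq_sum α β c 1 x (t + 1), Finset.sum_Icc_succ_top (by omega),
      Finset.sum_Icc_succ_top (by omega), ← honoured_eq_sum, ← abused_eq_sum]
    cases hx : x (t + 1) <;> simp [hp] <;> ring

theorem utilityAt_neg_iff {α β : ℕ} (hα : 1 ≤ α) (hβ : 1 ≤ β) {c : ℕ} {x : ℕ → Bool} {t : ℕ}
    (h : ∀ n < t, 0 ≤ utilityAt α β c 1 x n) :
    utilityAt α β c 1 x t < 0 ↔ uCrit α β c 1 ≤ walk c 1 x t := by
  rw [walk_eq_of_placesTrust h, utilityAt, expectedUtility_neg_iff hα hβ]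

theorem quittingTime_lt_top_iff {α β : ℕ} (hα : 1 ≤ α) (hβ : 1 ≤ β) (c : ℕ) (x : ℕ → Bool) :
    quittingTime α β c 1 x < ⊤ ↔ ∃ t, uCrit α β c 1 ≤ walk c 1 x t := by
  have h : quittingTime α β c 1 x < ⊤ ↔ ∃ t, utilityAt α β c 1 x t < 0 := by
    rw [quittingTime, sInf_lt_iff]
    constructor
    · rintro ⟨_, ⟨t, -, ht⟩, -⟩
      exact ⟨t, ht⟩
    · rintro ⟨t, ht⟩
      exact ⟨t, ⟨t, rfl, ht⟩, ENat.natCast_lt_top t⟩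
  rw [h]
  classical
  constructor
  · intro h
    -- After quitting, the counts freeze while the walk moves on, so the comparison is made at the
    -- first negative utility.
    exact ⟨Nat.find h, (utilityAt_neg_iff hα hβ fun n hn => not_lt.1 (Nat.find_min h hn)).1
      (Nat.find_spec h)⟩
  · rintro ⟨t, ht⟩
    by_contra! hne
    exact (hne t).not_gt ((utilityAt_neg_iff hα hβ fun n _ => hne n).2 ht)

/-! ### First-step analysis -/

/-- The probability that a walk stepping `-1` with probability `p` and `+c` with probability `1 - p`
reaches level `u` within `n` steps. -/
noncomputable def hitWithin (c : ℕ) (p : ℝ) : ℕ → ℤ → ℝ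
  | 0, u => if u ≤ 0 then 1 else 0
  | n + 1, u => if u ≤ 0 then 1 else p * hitWithin c p n (u + 1) + (1 - p) * hitWithin c p n (u - c)

theorem hitWithin_of_nonpos (c : ℕ) (p : ℝ) (n : ℕ) {u : ℤ} (hu : u ≤ 0) :
    hitWithin c p n u = 1 := by
  cases n <;> simp [hitWithin, hu]

theorem hitWithin_succ (c : ℕ) (p : ℝ) (n : ℕ) {u : ℤ} (hu : 0 < u) :
    hitWithin c p (n + 1) u =
      p * hitWithin c p n (u + 1) + (1 - p) * hitWithin c p n (u - c) := by
  simp [hitWithin, hu.not_ge]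

/-- The hypothesis `h` says that `z` to the power of the walk is a supermartingale; the bound is its
maximal inequality, proved by induction on the horizon. -/
theorem hitWithin_le_zpow {c : ℕ} {p z : ℝ} (hp : 0 ≤ p) (hp1 : p ≤ 1) (hz : 1 ≤ z)
    (h : (1 - p) * z ^ (c + 1) + p ≤ z) (n : ℕ) (u : ℤ) : hitWithin c p n u ≤ z ^ (-u) := by
  have hz0 : 0 < z := one_pos.trans_le hz
  rcases le_or_gt u 0 with hu | hu
  · rw [hitWithin_of_nonpos c p n hu]
    exact one_le_zpow₀ hz (by omega)
  induction n generalizing u with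
  | zero => simp only [hitWithin, hu.not_ge, if_false]; positivity
  | succ n ih =>
    have ih' : ∀ v : ℤ, hitWithin c p n v ≤ z ^ (-v) := fun v => by
      rcases le_or_gt v 0 with hv | hv
      · rw [hitWithin_of_nonpos c p n hv]
        exact one_le_zpow₀ hz (by omega)
      · exact ih v hv
    have hq : 0 ≤ 1 - p := sub_nonneg.2 hp1
    rw [hitWithin_succ c p n hu]
    calc p * hitWithin c p n (u + 1) + (1 - p) * hitWithin c p n (u - c)
        ≤ p * z ^ (-(u + 1)) + (1 - p) * z ^ (-(u - c)) := by gcongr <;> exact ih' _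
      _ = z ^ (-(u + 1)) * ((1 - p) * z ^ (c + 1) + p) := by
        have : z ^ (-(u - c)) = z ^ (-(u + 1)) * z ^ (c + 1) := by
          rw [← zpow_natCast z (c + 1), ← zpow_add₀ hz0.ne']
          congr 1
          push_cast
          ring
        rw [this]
        ring
      _ ≤ z ^ (-(u + 1)) * z := by gcongr
      _ = z ^ (-u) := by
        rw [← zpow_add_one₀ hz0.ne']
        congr 1
        ring

section Walk

variable {Ω : Type*} [MeasurableSpace Ω] {μ : Measure Ω} {X : ℕ → Ω → Bool}

theorem measurable_walk (hmeas : ∀ t, Measurable (X t)) (c t : ℕ) :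
    Measurable fun ω => walk c 1 (fun s => X s ω) t := by
  unfold walk
  refine Finset.measurable_fun_sum _ fun s _ => ?_
  exact (measurable_of_countable fun b : Bool => if b = true then -((1 : ℕ) : ℤ) else (c : ℤ)).comp
    (hmeas s)

theorem measurableSet_hit_within (hmeas : ∀ t, Measurable (X t)) (c n : ℕ) (u : ℤ) :
    MeasurableSet {ω | ∃ t ≤ n, u ≤ walk c 1 (fun s => X s ω) t} := by
  have : {ω | ∃ t ≤ n, u ≤ walk c 1 (fun s => X s ω) t} =
      ⋃ t ∈ Set.Iic n, {ω | u ≤ walk c 1 (fun s => X s ω) t} := by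
    ext ω; simp
  rw [this]
  exact MeasurableSet.biUnion (Set.to_countable _) fun t _ =>
    measurableSet_le measurable_const (measurable_walk hmeas c t)

theorem measureReal_inter_hit_shift [IsProbabilityMeasure μ] (hmeas : ∀ t, Measurable (X t))
    (hindep : iIndepFun X μ) (c n : ℕ) (v : ℤ) (b : Bool) :
    μ.real ({ω | X 1 ω = b} ∩ {ω | ∃ t ≤ n, v ≤ walk c 1 (fun s => X (s + 1) ω) t}) =
      μ.real {ω | X 1 ω = b} *
        μ.real {ω | ∃ t ≤ n, v ≤ walk c 1 (fun s => X (s + 1) ω) t} := by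
  have hdisj : Disjoint ({1} : Finset ℕ) (Finset.Icc 2 (n + 1)) := by simp
  have hI := hindep.indepFun_finset _ _ hdisj hmeas
  -- A finite horizon involves only responses `2` to `n + 1`, so every set of outcomes is
  -- measurable. The default `true` is never read.
  let B : Set (Finset.Icc 2 (n + 1) → Bool) := {y | ∃ t ≤ n, v ≤ walk c 1
    (fun s => if h : s + 1 ∈ Finset.Icc 2 (n + 1) then y ⟨s + 1, h⟩ else true) t}
  have h1 : {ω | X 1 ω = b} = (fun ω (i : ({1} : Finset ℕ)) => X i ω) ⁻¹'
      {y | y ⟨1, Finset.mem_singleton_self 1⟩ = b} := rfl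
  have h2 : {ω | ∃ t ≤ n, v ≤ walk c 1 (fun s => X (s + 1) ω) t} =
      (fun ω (i : Finset.Icc 2 (n + 1)) => X i ω) ⁻¹' B := by
    ext ω
    simp only [B, Set.mem_ofPred_eq, Set.mem_preimage]
    refine exists_congr fun t => and_congr_right fun ht => ?_
    rw [walk_congr c fun s hs => ?_]
    have hs' := Finset.mem_Icc.1 hs
    rw [dif_pos (Finset.mem_Icc.2 ⟨by omega, by omega⟩)]
  rw [h1, h2, measureReal_def, measureReal_def, measureReal_def,
    hI.measure_inter_preimage_eq_mul _ _ (Set.toFinite _).measurableSet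
      (Set.toFinite _).measurableSet, ENNReal.toReal_mul]

theorem measureReal_hit_within [IsProbabilityMeasure μ] {p : ℝ} (hmeas : ∀ t, Measurable (X t))
    (hindep : iIndepFun X μ) (hlaw : ∀ t, μ.real {ω | X t ω = true} = p) (c n : ℕ) (u : ℤ) :
    μ.real {ω | ∃ t ≤ n, u ≤ walk c 1 (fun s => X s ω) t} = hitWithin c p n u := by
  rcases le_or_gt u 0 with hu | hu
  · have : {ω | ∃ t ≤ n, u ≤ walk c 1 (fun s => X s ω) t} = Set.univ :=
      Set.eq_univ_of_forall fun ω => ⟨0, n.zero_le, by simpa [walk_zero] using hu⟩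
    rw [hitWithin_of_nonpos c p n hu, this, probReal_univ]
  -- `X` is generalized because the induction hypothesis is applied to the shifted sequence, which
  -- satisfies the same hypotheses.
  induction n generalizing X u with
  | zero => simp [hitWithin, walk_zero, hu.not_ge]
  | succ n ih =>
    let Y : ℕ → Ω → Bool := fun s => X (s + 1)
    have hYm : ∀ t, Measurable (Y t) := fun t => hmeas _
    have hYi : iIndepFun Y μ := hindep.precomp (g := fun s => s + 1) (add_left_injective 1)
    have ih' : ∀ v : ℤ, μ.real {ω | ∃ t ≤ n, v ≤ walk c 1 (fun s => Y s ω) t} =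
        hitWithin c p n v := fun v => by
      rcases le_or_gt v 0 with hv | hv
      · have : {ω | ∃ t ≤ n, v ≤ walk c 1 (fun s => Y s ω) t} = Set.univ :=
          Set.eq_univ_of_forall fun ω => ⟨0, n.zero_le, by simpa [walk_zero] using hv⟩
        rw [hitWithin_of_nonpos c p n hv, this, probReal_univ]
      · exact ih hYm hYi (fun t => hlaw _) v hv
    have hset : {ω | ∃ t ≤ n + 1, u ≤ walk c 1 (fun s => X s ω) t} =
        ({ω | X 1 ω = true} ∩ {ω | ∃ t ≤ n, u + 1 ≤ walk c 1 (fun s => Y s ω) t}) ∪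
        ({ω | X 1 ω = false} ∩ {ω | ∃ t ≤ n, u - c ≤ walk c 1 (fun s => Y s ω) t}) := by
      ext ω
      have hstep : (∃ t ≤ n + 1, u ≤ walk c 1 (fun s => X s ω) t) ↔
          ∃ t ≤ n, u ≤ walk c 1 (fun s => X s ω) (t + 1) := by
        constructor
        · rintro ⟨_ | t, ht, h⟩
          · rw [walk_zero] at h; omega
          · exact ⟨t, by omega, h⟩
        · rintro ⟨t, ht, h⟩
          exact ⟨t + 1, by omega, h⟩
      simp only [Set.mem_ofPred_eq, Set.mem_union, Set.mem_inter_iff, hstep, walk_succ', Y]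
      cases X 1 ω
      · simp [add_comm]
      · simp [le_neg_add_iff_add_le, add_comm]
    have hfalse : μ.real {ω | X 1 ω = false} = 1 - p := by
      have hms : MeasurableSet {ω | X 1 ω = true} := hmeas 1 (measurableSet_singleton true)
      have : {ω | X 1 ω = false} = {ω | X 1 ω = true}ᶜ := by ext ω; simp
      rw [this, probReal_compl_eq_one_sub hms, hlaw]
    rw [hset, measureReal_union, measureReal_inter_hit_shift hmeas hindep,
      measureReal_inter_hit_shift hmeas hindep, hlaw, hfalse, ih', ih', hitWithin_succ c p n hu]
    · refine Set.disjoint_left.2 fun ω h1 h2 => ?_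
      have := h1.1.symm.trans h2.1
      simp at this
    · exact (hmeas 1 (measurableSet_singleton false)).inter (measurableSet_hit_within hYm c n _)

theorem tendsto_hitWithin [IsProbabilityMeasure μ] {p : ℝ} (hmeas : ∀ t, Measurable (X t))
    (hindep : iIndepFun X μ) (hlaw : ∀ t, μ.real {ω | X t ω = true} = p) (c : ℕ) (u : ℤ) :
    Filter.Tendsto (fun n => hitWithin c p n u) Filter.atTop (nhds (hitProb μ X c 1 u)) := by
  have hset : {ω | ∃ t, u ≤ walk c 1 (fun s => X s ω) t} =
      ⋃ n, {ω | ∃ t ≤ n, u ≤ walk c 1 (fun s => X s ω) t} := by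
    ext ω
    simp only [Set.mem_ofPred_eq, Set.mem_iUnion]
    exact ⟨fun ⟨t, h⟩ => ⟨t, t, le_rfl, h⟩, fun ⟨_, t, _, h⟩ => ⟨t, h⟩⟩
  have hmono : Monotone fun n => {ω | ∃ t ≤ n, u ≤ walk c 1 (fun s => X s ω) t} :=
    fun m n hmn ω ⟨t, ht, h⟩ => ⟨t, ht.trans hmn, h⟩
  simp only [← measureReal_hit_within hmeas hindep hlaw]
  rw [hitProb, hset]
  exact (ENNReal.tendsto_toReal (measure_ne_top _ _)).comp (tendsto_measure_iUnion_atTop hmono)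

end Walk

/-! ### The hitting probabilities -/

theorem mul_apply_one_eq {A : ℤ → ℝ} {c : ℕ} {p q L : ℝ} (h0 : ∀ u ≤ 0, A u = 1)
    (hrec : ∀ u, 0 < u → A u = p * A (u + 1) + q * A (u - c)) (hpq : p + q = 1)
    (hL : Filter.Tendsto A Filter.atTop (nhds L)) (hd : L * (p - q * c) = 0) :
    p * A 1 = q * c := by
  -- The conserved quantity: passing from `N` to `N + 1` changes it by the recurrence at `N + 1`. At
  -- `N = 0` all `c` summands equal `1`.
  have hconst : ∀ N : ℕ, p * A (N + 1) - q * ∑ j ∈ Finset.range c, A (N - j) =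
      p * A 1 - q * c := by
    intro N
    induction N with
    | zero =>
      rw [Finset.sum_congr rfl fun j _ => h0 _ (by simp)]
      simp
    | succ N ih =>
      have hs : ∑ j ∈ Finset.range c, A (N - j) + A (N + 1) =
          ∑ j ∈ Finset.range c, A (N + 1 - j) + A (N + 1 - c) := by
        rw [← Finset.sum_range_succ (fun j : ℕ => A (N + 1 - j)), Finset.sum_range_succ']
        simp
      have hr := hrec (N + 1) (by positivity)
      push_cast
      linear_combination ih - hr - A (N + 1) * hpq + q * hs
  have hcast : Filter.Tendsto (fun N : ℕ => (N : ℤ)) Filter.atTop Filter.atTop :=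
    tendsto_natCast_atTop_atTop
  have hlim : Filter.Tendsto
      (fun N : ℕ => p * A (N + 1) - q * ∑ j ∈ Finset.range c, A (N - j)) Filter.atTop
      (nhds (p * L - q * ∑ _j ∈ Finset.range c, L)) := by
    refine ((hL.comp (Filter.tendsto_atTop_add_const_right _ 1 hcast)).const_mul p).sub
      ((tendsto_finsetSum _ fun j _ => ?_).const_mul q)
    exact hL.comp (Filter.tendsto_atTop_add_const_right _ (-(j : ℤ)) hcast)
  simp only [hconst] at hlim
  have := tendsto_nhds_unique hlim tendsto_const_nhds
  simp at this
  linarith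

/-- Dividing `(1 - p) * z ^ (c + 1) + p - z` by `z - 1` leaves `(1 - p) * ∑ z ^ k - 1`, negative at
`z = 1` and hence just to its right. -/
theorem exists_one_lt_of_drift_neg {c : ℕ} {p : ℝ} (h : (1 - p) * (c + 1) < 1) :
    ∃ z : ℝ, 1 < z ∧ (1 - p) * z ^ (c + 1) + p ≤ z := by
  have hcont : Continuous fun z : ℝ => (1 - p) * ∑ k ∈ Finset.range (c + 1), z ^ k := by fun_prop
  have hev : ∀ᶠ z : ℝ in nhds 1, (1 - p) * ∑ k ∈ Finset.range (c + 1), z ^ k < 1 :=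
    hcont.continuousAt.eventually_lt_const (by simpa using h)
  obtain ⟨z, hz, hz1⟩ := ((hev.filter_mono nhdsWithin_le_nhds).and
    (self_mem_nhdsWithin : Set.Ioi (1 : ℝ) ∈ nhdsWithin 1 (Set.Ioi 1))).exists
  refine ⟨z, hz1, ?_⟩
  have hg := geom_sum_mul z (c + 1)
  have hz1' : 0 < z - 1 := sub_pos.2 hz1
  nlinarith [mul_lt_mul_of_pos_right hz hz1']

section HitProb

variable {Ω : Type*} [MeasurableSpace Ω] {μ : Measure Ω} [IsProbabilityMeasure μ]
  {X : ℕ → Ω → Bool} {p : ℝ}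

theorem hitProb_of_nonpos (c : ℕ) {u : ℤ} (hu : u ≤ 0) : hitProb μ X c 1 u = 1 := by
  have : {ω | ∃ t, u ≤ walk c 1 (fun s => X s ω) t} = Set.univ :=
    Set.eq_univ_of_forall fun ω => ⟨0, by simpa [walk_zero] using hu⟩
  rw [hitProb, this, probReal_univ]

theorem hitProb_antitone (c : ℕ) : Antitone (hitProb μ X c 1) := fun _ _ huv =>
  measureReal_mono fun _ ⟨t, h⟩ => ⟨t, huv.trans h⟩

theorem hitProb_eq (hmeas : ∀ t, Measurable (X t)) (hindep : iIndepFun X μ)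
    (hlaw : ∀ t, μ.real {ω | X t ω = true} = p) (c : ℕ) {u : ℤ} (hu : 0 < u) :
    hitProb μ X c 1 u =
      p * hitProb μ X c 1 (u + 1) + (1 - p) * hitProb μ X c 1 (u - c) := by
  have ht := tendsto_hitWithin hmeas hindep hlaw c
  refine tendsto_nhds_unique ((ht u).comp (Filter.tendsto_add_atTop_nat 1)) ?_
  simp only [Function.comp_def, hitWithin_succ c p _ hu]
  exact ((ht _).const_mul p).add ((ht _).const_mul (1 - p))

theorem mul_hitProb_one (hmeas : ∀ t, Measurable (X t)) (hindep : iIndepFun X μ)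
    (hlaw : ∀ t, μ.real {ω | X t ω = true} = p) {c : ℕ} (hp : 0 ≤ p) (hp1 : p ≤ 1)
    (hd : (1 - p) * (c + 1) ≤ 1) : p * hitProb μ X c 1 1 = (1 - p) * c := by
  have hbdd : BddBelow (Set.range (hitProb μ X c 1)) := ⟨0, by
    rintro _ ⟨u, rfl⟩
    exact measureReal_nonneg⟩
  have hL := tendsto_atTop_ciInf (hitProb_antitone (μ := μ) (X := X) c) hbdd
  refine mul_apply_one_eq (fun u hu => hitProb_of_nonpos c hu)
    (fun u hu => hitProb_eq hmeas hindep hlaw c hu) (by ring) hL ?_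
  -- Negative drift forces the limit of the hitting probabilities to be `0`; at zero drift the other
  -- factor vanishes, whatever the limit.
  rcases hd.lt_or_eq with hd | hd
  · obtain ⟨z, hz1, hz⟩ := exists_one_lt_of_drift_neg hd
    have hle : ∀ n : ℕ, ⨅ u, hitProb μ X c 1 u ≤ z⁻¹ ^ n := fun n => by
      refine (ciInf_le hbdd (n : ℤ)).trans (le_of_tendsto'
        (tendsto_hitWithin hmeas hindep hlaw c n) fun m => ?_)
      simpa using hitWithin_le_zpow hp hp1 hz1.le hz m n
    have h0 : ⨅ u, hitProb μ X c 1 u ≤ 0 :=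
      ge_of_tendsto' (tendsto_pow_atTop_nhds_zero_of_lt_one (by positivity) (inv_lt_one_of_one_lt₀ hz1))
        hle
    rw [le_antisymm h0 (le_ciInf fun u => measureReal_nonneg), zero_mul]
  · rw [show p - (1 - p) * c = 0 by linarith, mul_zero]

end HitProb

/-! ### The generating function -/

theorem xiDen_eval (c : ℕ) (p w : ℝ) :
    (xiDen c p).eval w = (1 - w) * (w - p - (1 - p) * w ^ (c + 1)) := by
  simp [xiDen]
  ring

theorem xiNum_eval (c : ℕ) (p w : ℝ) :
    (xiNum c p).eval w = ((1 - p) * (c + 1) - 1) * w ^ 2 + (2 - (1 - p) * (c + 1)) * w -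
      (1 - p) * w ^ (c + 1) - p := by
  simp [xiNum]

theorem xiDen_eval_ne_zero {c : ℕ} (hc : 1 ≤ c) {p : ℝ} (hp1 : p ≤ 1) (hd : (1 - p) * (c + 1) ≤ 1)
    {w : ℝ} (hw : |w| < 1) : (xiDen c p).eval w ≠ 0 := by
  have hw1 : 0 < 1 - w := sub_pos.2 (abs_lt.1 hw).2
  -- The term `w ^ 0 = 1` is kept apart: only the positive powers, present since `c ≥ 1`, give the
  -- strict inequality needed when `(1 - p) * (c + 1) = 1`.
  have hS : ∑ k ∈ Finset.range c, w ^ (k + 1) ≤ c * |w| := by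
    have : ∀ k ∈ Finset.range c, w ^ (k + 1) ≤ |w| := fun k _ =>
      (le_abs_self _).trans (by
        rw [abs_pow]
        exact pow_le_of_le_one (abs_nonneg w) hw.le (by omega))
    simpa using Finset.sum_le_card_nsmul _ _ _ this
  have hg := geom_sum_mul w (c + 1)
  rw [Finset.sum_range_succ'] at hg
  rw [xiDen_eval]
  refine mul_ne_zero hw1.ne' ?_
  set S := ∑ k ∈ Finset.range c, w ^ (k + 1)
  have hlt : (1 - p) * (S + 1) < 1 := by
    rcases hp1.lt_or_eq with h | rfl
    · have : (c : ℝ) * |w| < c := mul_lt_of_lt_one_right (by exact_mod_cast hc) hw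
      nlinarith [mul_lt_mul_of_pos_left (hS.trans_lt this) (sub_pos.2 h)]
    · simp
  have : w - p - (1 - p) * w ^ (c + 1) = (1 - w) * ((1 - p) * (S + 1) - 1) := by
    linear_combination (1 - p) * hg
  rw [this]
  exact mul_ne_zero hw1.ne' (by linarith)

theorem hasSum_xi {A : ℤ → ℝ} {c : ℕ} {p w : ℝ} (h0 : ∀ u ≤ 0, A u = 1) (hnn : ∀ u, 0 ≤ A u)
    (hle : ∀ u, A u ≤ 1) (hrec : ∀ u, 0 < u → A u = p * A (u + 1) + (1 - p) * A (u - c))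
    (h1 : p * A 1 = (1 - p) * c) (hw : |w| < 1) (hden : (xiDen c p).eval w ≠ 0) :
    HasSum (fun u : ℕ => A u * w ^ u) (xi c p w) := by
  have hsum : Summable fun u : ℕ => A u * w ^ u :=
    Summable.of_norm_bounded (summable_geometric_of_abs_lt_one hw).abs fun u => by
      rw [Real.norm_eq_abs, abs_mul, abs_of_nonneg (hnn u)]
      exact mul_le_of_le_one_left (abs_nonneg _) (hle u)
  obtain ⟨G, hG⟩ := hsum
  have hG1 : HasSum (fun u : ℕ => A (u + 1) * w ^ (u + 1)) (G - 1) := by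
    have := (hasSum_nat_add_iff' 1).2 hG
    simpa [h0] using this
  have hG2 : HasSum (fun u : ℕ => A (u + 1 + 1) * w ^ (u + 1 + 1)) (G - 1 - A 1 * w) := by
    have := (hasSum_nat_add_iff' 1).2 hG1
    simpa using this
  have hB : HasSum (fun u : ℕ => A (u - c) * w ^ u) (w ^ c * G + ∑ i ∈ Finset.range c, w ^ i) := by
    rw [← hasSum_nat_add_iff' c]
    have hfin : ∑ i ∈ Finset.range c, A (i - c) * w ^ i = ∑ i ∈ Finset.range c, w ^ i :=
      Finset.sum_congr rfl fun i hi => by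
        have := Finset.mem_range.1 hi
        rw [h0 _ (by omega), one_mul]
    rw [hfin, add_sub_cancel_right]
    convert! hG.mul_left (w ^ c) using 2 with u
    push_cast
    rw [add_sub_cancel_right, pow_add]
    ring
  have hB1 : HasSum (fun u : ℕ => A (u + 1 - c) * w ^ (u + 1))
      (w ^ c * G + ∑ i ∈ Finset.range c, w ^ i - 1) := by
    have := (hasSum_nat_add_iff' 1).2 hB
    simpa [h0] using this
  -- The recurrence at `u + 1`, multiplied by `w ^ (u + 2)` and summed over `u ≥ 0`.
  have hE : w * (G - 1) = p * (G - 1 - A 1 * w) +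
      (1 - p) * w * (w ^ c * G + ∑ i ∈ Finset.range c, w ^ i - 1) := by
    refine (hG1.mul_left w).unique ?_
    convert! (hG2.mul_left p).add (hB1.mul_left ((1 - p) * w)) using 2 with u
    rw [hrec (u + 1) (by positivity)]
    ring
  have hxi : xi c p w = G := by
    rw [xi, div_eq_iff hden, xiDen_eval, xiNum_eval]
    have hg := geom_sum_mul w c
    rw [pow_succ]
    linear_combination (-(1 - w)) * hE + (1 - p) * w * hg + (1 - w) * w * h1
  rwa [hxi]

theorem eq_iteratedDeriv_div_factorial_of_hasSum {a : ℕ → ℝ} {f : ℝ → ℝ} {r : ℝ} (hr : 0 < r)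
    (h : ∀ w ∈ Set.Ioo (-r) r, HasSum (fun n => a n * w ^ n) (f w)) (n : ℕ) :
    a n = iteratedDeriv n f 0 / n.factorial := by
  have hf : HasFPowerSeriesAt f (FormalMultilinearSeries.ofScalars ℝ a) 0 := by
    rw [hasFPowerSeriesAt_iff']
    filter_upwards [Ioo_mem_nhds (neg_lt_zero.2 hr) hr] with w hw
    simpa [mul_comm] using h w hw
  have := congrArg (fun q => q.coeff n)
    (hf.eq_formalMultilinearSeries (AnalyticAt.hasFPowerSeriesAt ⟨_, hf⟩))
  simpa using this

theorem xiNum_natDegree {c : ℕ} (hc : 1 ≤ c) {p : ℝ} (hp : 0 < p) (hp1 : p < 1) :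
    (xiNum c p).natDegree = c + 1 := by
  refine natDegree_eq_of_le_of_coeff_ne_zero ?_ ?_
  · unfold xiNum
    compute_degree
    omega
  -- For `c = 1` the `X ^ 2` and `X ^ (c + 1)` terms merge, with leading coefficient `-p`; this is
  -- where `0 < p` enters.
  · rcases hc.eq_or_lt with rfl | hc
    · simp only [xiNum, coeff_sub, coeff_add, coeff_C_mul, coeff_X_pow, coeff_X, coeff_C]
      norm_num
      intro h
      linarith
    · have h2 : c + 1 ≠ 2 := by omega
      have h1 : c ≠ 0 := by omega
      simp only [xiNum, coeff_sub, coeff_add, coeff_C_mul, coeff_X_pow, coeff_X, coeff_C]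
      simpa [h2, h1, Ne.symm h1] using (sub_neg.2 hp1).ne

theorem xiDen_natDegree {c : ℕ} (hc : 1 ≤ c) {p : ℝ} (hp1 : p < 1) :
    (xiDen c p).natDegree = c + 2 := by
  have hq : 1 - p ≠ 0 := (sub_pos.2 hp1).ne'
  refine natDegree_eq_of_le_of_coeff_ne_zero ?_ ?_
  · unfold xiDen
    compute_degree
  · have h1 : c ≠ 0 := by omega
    simp only [xiDen, coeff_sub, coeff_add, coeff_C_mul, coeff_X_pow, coeff_X, coeff_C]
    simpa [h1, Ne.symm h1] using hq

end TrustModel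

theorem lemma5 {Ω : Type*} [MeasurableSpace Ω] (μ : Measure Ω) [IsProbabilityMeasure μ]
    (X : ℕ → Ω → Bool) (ϑ : ℝ) (c : ℕ) (hc : 1 ≤ c)
    (hϑ : (c : ℝ) / ((c : ℝ) + 1) ≤ ϑ) (hϑ1 : ϑ ≤ 1)
    (hmeas : ∀ t, Measurable (X t)) (hindep : iIndepFun X μ)
    (hlaw : ∀ t, μ.real {ω | X t ω = true} = ϑ) :
    -- degrees of numerator and denominator, and no pole in `(-1, 1)`
    (ϑ < 1 → (TrustModel.xiNum c ϑ).natDegree = c + 1 ∧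
      (TrustModel.xiDen c ϑ).natDegree = c + 2) ∧
    (∀ w ∈ Set.Ioo (-1 : ℝ) 1, (TrustModel.xiDen c ϑ).eval w ≠ 0) ∧
    -- the generating function of the hitting probabilities
    (∀ w ∈ Set.Ioo (-1 : ℝ) 1,
      HasSum (fun u : ℕ => TrustModel.hitProb μ X c 1 (u : ℤ) * w ^ u) (TrustModel.xi c ϑ w)) ∧
    -- the hitting probabilities
    (∀ u : ℕ, TrustModel.hitProb μ X c 1 (u : ℤ) =
      iteratedDeriv u (TrustModel.xi c ϑ) 0 / (u.factorial : ℝ)) ∧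
    -- the quitting probability
    (∀ α β : ℕ, 1 ≤ α → 1 ≤ β →
      TrustModel.quitProb μ X α β c 1 =
        TrustModel.hitProb μ X c 1 (TrustModel.uCrit α β c 1)) := by
  have hc0 : (0 : ℝ) < c := by exact_mod_cast hc
  have hϑ0 : 0 < ϑ := (by positivity : (0 : ℝ) < c / (c + 1)).trans_le hϑ
  -- The mean step is `(1 - ϑ) * (c + 1) - 1`, so this is nonpositive drift.
  have hd : (1 - ϑ) * (c + 1) ≤ 1 := by
    rw [div_le_iff₀ (by positivity)] at hϑ
    linarith
  have hden : ∀ w ∈ Set.Ioo (-1 : ℝ) 1, (TrustModel.xiDen c ϑ).eval w ≠ 0 := fun w hw =>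
    TrustModel.xiDen_eval_ne_zero hc hϑ1 hd (abs_lt.2 hw)
  have hsum : ∀ w ∈ Set.Ioo (-1 : ℝ) 1,
      HasSum (fun u : ℕ => TrustModel.hitProb μ X c 1 (u : ℤ) * w ^ u) (TrustModel.xi c ϑ w) :=
    fun w hw => TrustModel.hasSum_xi (fun u hu => TrustModel.hitProb_of_nonpos c hu)
      (fun u => measureReal_nonneg) (fun u => measureReal_le_one)
      (fun u hu => TrustModel.hitProb_eq hmeas hindep hlaw c hu)
      (TrustModel.mul_hitProb_one hmeas hindep hlaw hϑ0.le hϑ1 hd) (abs_lt.2 hw) (hden w hw)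
  refine ⟨fun h => ⟨TrustModel.xiNum_natDegree hc hϑ0 h, TrustModel.xiDen_natDegree hc h⟩, hden,
    hsum, fun u => TrustModel.eq_iteratedDeriv_div_factorial_of_hasSum one_pos hsum u,
    fun α β hα hβ => ?_⟩
  simp only [TrustModel.quitProb, TrustModel.hitProb, TrustModel.quittingTime_lt_top_iff hα hβ]
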